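/- Conventions. Let $S^{2n-1}$ be the unit sphere of $\mathbb{C}^n$ with its Hermitian norm; the spheres $rS^{2n-1}$, $r>0$, are called zero-centric. A rational map $f=\frac{p}{q}\colon\mathbb{C}^n\dashrightarrow\mathbb{C}^N$ is written in lowest terms ($p$ an $N$-tuple of polynomials, $q\neq 0$ a polynomial, with no nonconstant common factor of $q$ and all components of $p$); its pole set is $\{q=0\}$ and its degree is $\max(\deg p,\deg q)$. For an integer $m\ge 1$, $f$ is an $m$-fold sphere map if there are $0<r_1<\dots<r_m<\infty$ and $0<R_1,\dots,R_m<\infty$ such that, for every $j$, the pole set of $f$ misses $r_jS^{2n-1}$ and $f(r_jS^{2n-1})\subset R_jS^{2N-1}$. If there are infinitely many such radii $r_j$ (each with some $R_j>0$), $f$ is an $\infty$-fold sphere map. A homogeneous sphere map of degree $d$ is a map $h\colon\mathbb{C}^n\to\mathbb{C}^{\ell}$ whose components are homogeneous polynomials of degree $d$ and that takes some zero-centric sphere into a zero-centric sphere. The symmetrized $d$-fold tensor power $H_d$ of the identity of $\mathbb{C}^n$ is the map with components $\sqrt{\tfrac{d!}{\alpha!}}\,z^\alpha$, $|\alpha|=d$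 (in any order), so that $\|H_d(z)\|^2=\|z\|^{2d}$. Theorem. Let $n\ge 2$ and let $f\colon\mathbb{C}^n\dashrightarrow\mathbb{C}^N$ be a rational map. (i) If, for some integer $m \geq 1$, $f$ is an $m$-fold sphere map and a polynomial map of degree $m$ or less, then $f$ is an $\infty$-fold sphere map. (ii) If, for some integer $m \geq 1$, $f$ is an $m$-fold sphere map and a rational map of degree $m-1$ or less, then $f$ is an $\infty$-fold sphere map. (iii) If $f$ is an $\infty$-fold sphere map, then $f$ is polynomial, and for every $r>0$ there exists $R>0$ such that $f(rS^{2n-1})\subset RS^{2N-1}$. Moreover, there exist a unitary $U\in U(\mathbb{C}^N)$, integers $0\le d_1<\dots<d_k$, numbers $c_1,\dots,c_k>0$ and homogeneous sphere maps $h_j\colon\mathbb{C}^n\to\mathbb{C}^{\ell_j}$ of degree $d_j$ (constant if $d_j=0$), $j=1,\dots,k$, with $\ell_1+\dots+\ell_k\le N$, such that $h_j=c_jH_{d_j}$ for every $j$ and $$f=U(h_1\oplus\cdots\oplus h_k\oplus 0).$$ -/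

import Mathlib

/-- Complex Euclidean space `ℂⁿ` with its Hermitian norm. -/
abbrev CSpace (n : ℕ) : Type := EuclideanSpace ℂ (Fin n)

/-- A rational map `ℂⁿ ⇢ ℂᴺ`, written in lowest terms as `p / q` with `p` an `N`-tuple of
polynomials and `q` a single nonzero polynomial: no nonconstant polynomial divides `q` and all
components of `p`. Such an expression exists for every `N`-tuple of rational functions and is
unique up to multiplying `p` and `q` by the same nonzero constant. -/
structure RationalMap (n N : ℕ) where
  num : Fin N → MvPolynomial (Fin n) ℂ
  den : MvPolynomial (Fin n) ℂ
  den_ne_zero : den ≠ 0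
  reduced : ∀ d : MvPolynomial (Fin n) ℂ, d ∣ den → (∀ i, d ∣ num i) → IsUnit d

namespace RationalMap

variable {n N : ℕ}

/-- The value `p(z) / q(z)` (meaningful off the pole set). -/
noncomputable def toFun (f : RationalMap n N) (z : CSpace n) : CSpace N :=
  WithLp.toLp 2 fun i =>
    MvPolynomial.eval (fun a => z a) (f.num i) / MvPolynomial.eval (fun a => z a) f.den

/-- The pole set: the zero set of the denominator in lowest terms. -/
def poleSet (f : RationalMap n N) : Set (CSpace n) :=
  {z | MvPolynomial.eval (fun a => z a) f.den = 0}

/-- The degree of a rational map: the maximum of the degrees of the numerator and of the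
denominator in lowest terms. -/
def degree (f : RationalMap n N) : ℕ :=
  max (Finset.univ.sup fun i => (f.num i).totalDegree) f.den.totalDegree

/-- The rational map is a polynomial map `P`, i.e. `p / q = P`. -/
def IsPolynomial (f : RationalMap n N) : Prop :=
  ∃ P : Fin N → MvPolynomial (Fin n) ℂ, ∀ i, f.num i = f.den * P i

/-- The pole set of `f` misses the zero-centric sphere of radius `r`, and `f` maps this sphere
into the zero-centric sphere of radius `R`. -/
def MapsSphere (f : RationalMap n N) (r R : ℝ) : Prop :=
  Disjoint f.poleSet (Metric.sphere 0 r) ∧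
    Set.MapsTo f.toFun (Metric.sphere 0 r) (Metric.sphere 0 R)

/-- `f` is an `m`-fold sphere map (`m` finite). -/
def IsFoldSphereMap (f : RationalMap n N) (m : ℕ) : Prop :=
  ∃ r R : Fin m → ℝ, StrictMono r ∧ (∀ j, 0 < r j) ∧ (∀ j, 0 < R j) ∧
    ∀ j, f.MapsSphere (r j) (R j)

/-- `f` is an `∞`-fold sphere map: there are infinitely many zero-centric spheres that are
mapped into zero-centric spheres. -/
def IsInftyFoldSphereMap (f : RationalMap n N) : Prop :=
  {r : ℝ | 0 < r ∧ ∃ R : ℝ, 0 < R ∧ f.MapsSphere r R}.Infinite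

end RationalMap

/-- `h : ℂⁿ → ℂˡ` is a homogeneous sphere map of degree `d`: its components are homogeneous
polynomials of degree `d`, and it maps some zero-centric sphere into a zero-centric sphere. -/
def IsHomogeneousSphereMap {n l : ℕ} (d : ℕ) (h : CSpace n → CSpace l) : Prop :=
  (∃ P : Fin l → MvPolynomial (Fin n) ℂ, (∀ i, (P i).IsHomogeneous d) ∧
    ∀ z i, h z i = MvPolynomial.eval (fun a => z a) (P i)) ∧
  ∃ r R : ℝ, 0 < r ∧ 0 < R ∧ Set.MapsTo h (Metric.sphere 0 r) (Metric.sphere 0 R)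

/-- `h : ℂⁿ → ℂˡ` is `c` times the symmetrized `d`-fold tensor power `H_d` of the identity: its
components are, in some order and each exactly once, the monomials
`c * √(d! / α!) * z ^ α` with `|α| = d`. -/
def IsScaledSymmetrizedPower {n l : ℕ} (d : ℕ) (c : ℝ) (h : CSpace n → CSpace l) : Prop :=
  ∃ σ : Fin l ≃ {α : Fin n → ℕ // ∑ a, α a = d}, ∀ z i,
    h z i = (c : ℂ) * (Real.sqrt (Nat.multinomial Finset.univ (σ i).1) : ℂ) *
      ∏ a, z a ^ (σ i).1 a

/-- The map `h₁ ⊕ ⋯ ⊕ h_k ⊕ 0 : ℂⁿ → ℂᴺ`: the components of `h₁, …, h_k` listed one after the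
other and followed by zeros. (It is used for `∑ j, l j ≤ N`.) -/
noncomputable def directSumZero {n k : ℕ} (N : ℕ) {l : Fin k → ℕ}
    (h : ∀ j, CSpace n → CSpace (l j)) (z : CSpace n) : CSpace N :=
  WithLp.toLp 2 fun i =>
    if hi : i.1 < ∑ j, l j then
      h (finSigmaFinEquiv.symm ⟨i.1, hi⟩).1 z (finSigmaFinEquiv.symm ⟨i.1, hi⟩).2
    else 0

open MvPolynomial ComplexConjugate

/-! Write `f = p / q`, let `D` bound the degrees of `p` and `q`, and let subscripts denote
homogeneous parts. On a mapped sphere `‖z‖² = x` one has `‖p‖² = y |q|²`. On the circle where this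
sphere meets the complex line through `0` and `z`, the conjugate parameter is `x / (s t)` with `s =
‖z‖²`. Clearing denominators gives a polynomial identity in `t`, valid on the whole line
(`sum_mul_reflected_eq`). At `t = 1` it reads `∑ b, x ^ b s ^ (D - b) ⟨p, p_b⟩ = y q ∑ b, x ^ b s ^
(D - b) conj q_b` for every `z ≠ 0`, and `conj z` may then be replaced by an independent variable
`w` (`eq_zero_of_evalPair_conj`).

Modulo `q`, the left side is a polynomial in `x` with `D + 1` coefficients that vanishes at `D + 1`
values, so `q` divides each coefficient. Since `q(z)` is coprime to `∑ z_a w_a` when `n ≥ 2`, it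
divides every `⟨p, p_b⟩`, hence the polarized `‖p‖²`, and linear algebra gives `q ∣ p_i`
(`den_dvd_num_of_spheres`). In lowest terms `f` is then polynomial.

For polynomial `p`, comparing powers of `t` on lines through unit vectors shows that `D` spheres
already force homogeneous parts of different degrees to be orthogonal and each part to have constant
norm on the unit sphere (`homGram_eq_of_spheres`). So `‖p‖²` is a polynomial in `‖z‖²` with
nonnegative coefficients, and every sphere is mapped to a sphere. Comparing monomials in its
polarization, the coefficient vectors of `p` are orthogonal with the same norms as those of an
orthogonal sum of multiples of the `H_d`; a unitary map matches the two families
(`exists_unitary_eq_directSumZero`). -/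

/-- A polynomial expression `∑ b < D, x ^ b • v b` that lies in a submodule for at least `D`
values of `x` has all its coefficients in that submodule. -/
theorem mem_of_sum_pow_smul_mem {V : Type*} [AddCommGroup V] [Module ℂ V] (W : Submodule ℂ V)
    (S : Finset ℂ) {D : ℕ} (hS : D ≤ S.card) (v : ℕ → V)
    (h : ∀ x ∈ S, ∑ b ∈ Finset.range D, x ^ b • v b ∈ W) {b : ℕ} (hb : b < D) : v b ∈ W := by
  classical
  let c : ℂ → ℂ := fun x => (Lagrange.basis S id x).coeff b
  -- Interpolation at the nodes `S` reproduces `X ^ b'`; its coefficient at `X ^ b` gives weights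
  -- that isolate `v b`.
  have key : ∀ b' < D, ∑ x ∈ S, c x * x ^ b' = if b = b' then 1 else 0 := by
    intro b' hb'
    have hdeg : (Polynomial.X ^ b' : Polynomial ℂ).degree < S.card := by
      rw [Polynomial.degree_X_pow]
      exact_mod_cast hb'.trans_le hS
    have h1 := congrArg (fun P => Polynomial.coeff P b)
      (Lagrange.eq_interpolate (v := id) (s := S) (Function.injective_id.injOn) hdeg)
    simp only [Lagrange.interpolate_apply, Polynomial.finsetSum_coeff, Polynomial.coeff_C_mul,
      Polynomial.eval_pow, Polynomial.eval_X, Polynomial.coeff_X_pow, id] at h1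
    rw [h1]
    exact Finset.sum_congr rfl fun x _ => mul_comm _ _
  have h2 : ∑ x ∈ S, c x • ∑ b' ∈ Finset.range D, x ^ b' • v b' = v b := by
    simp only [Finset.smul_sum, smul_smul]
    rw [Finset.sum_comm]
    simp only [← Finset.sum_smul]
    rw [Finset.sum_eq_single b]
    · rw [key b hb, if_pos rfl, one_smul]
    · intro b' hb' hne
      rw [key b' (Finset.mem_range.1 hb'), if_neg (Ne.symm hne), zero_smul]
    · intro hb'
      exact absurd (Finset.mem_range.2 hb) hb'
  rw [← h2]
  exact W.sum_mem fun x hx => W.smul_mem _ (h x hx)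

/-! ### Restriction to complex lines and polarization -/

section Homogeneous

variable {n : ℕ}

theorem eval_mul_of_isHomogeneous {g : MvPolynomial (Fin n) ℂ} {b : ℕ} (hg : g.IsHomogeneous b)
    (t : ℂ) (z : Fin n → ℂ) : eval (fun a => t * z a) g = t ^ b * eval z g := by
  rw [eval_eq', eval_eq', Finset.mul_sum]
  refine Finset.sum_congr rfl fun d hd => ?_
  have h1 : ∑ a, d a = b := by
    rw [← hg (mem_support_iff.1 hd), Finsupp.weight_apply, Finsupp.sum_fintype _ _ (by simp)]
    simp
  have h2 : ∀ a : Fin n, (t * z a) ^ d a = t ^ d a * z a ^ d a := fun a => mul_pow _ _ _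
  simp_rw [h2]
  rw [Finset.prod_mul_distrib, Finset.prod_pow_eq_pow_sum, h1]
  ring

theorem sum_homogeneousComponent_of_le {g : MvPolynomial (Fin n) ℂ} {D : ℕ}
    (hg : g.totalDegree ≤ D) :
    ∑ b ∈ Finset.range (D + 1), homogeneousComponent b g = g := by
  conv_rhs => rw [← sum_homogeneousComponent g]
  symm
  refine Finset.sum_subset (Finset.range_subset_range.2 (by omega)) fun b _ hb => ?_
  exact homogeneousComponent_eq_zero _ _ (by simpa [Nat.lt_succ_iff] using hb)

theorem eval_eq_sum_homogeneousComponent {g : MvPolynomial (Fin n) ℂ} {D : ℕ}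
    (hg : g.totalDegree ≤ D) (z : Fin n → ℂ) :
    eval z g = ∑ b ∈ Finset.range (D + 1), eval z (homogeneousComponent b g) := by
  conv_lhs => rw [← sum_homogeneousComponent_of_le hg]
  rw [map_sum]

theorem eval_mul_eq_sum {g : MvPolynomial (Fin n) ℂ} {D : ℕ}
    (hg : g.totalDegree ≤ D) (t : ℂ) (z : Fin n → ℂ) :
    eval (fun a => t * z a) g =
      ∑ b ∈ Finset.range (D + 1), t ^ b * eval z (homogeneousComponent b g) := by
  rw [eval_eq_sum_homogeneousComponent hg]
  exact Finset.sum_congr rfl fun b _ =>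
    eval_mul_of_isHomogeneous (homogeneousComponent_isHomogeneous b g) t z

/-- The polynomial `g` with conjugated values, restricted to a circle `|t|² s = x` in a complex
line and cleared of denominators, expressed through the homogeneous components of `g`. -/
noncomputable def reflected (g : MvPolynomial (Fin n) ℂ) (D : ℕ) (x s t : ℂ) (z : Fin n → ℂ) : ℂ :=
  ∑ b ∈ Finset.range (D + 1), x ^ b * (s * t) ^ (D - b) * conj (eval z (homogeneousComponent b g))

/-- On the circle each factor `conj t` absorbs one factor `s * t` into `x`; since the degree is at
most `D`, the prefactor `(s * t) ^ D` suffices and no negative powers remain. -/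
theorem reflected_eq {g : MvPolynomial (Fin n) ℂ} {D : ℕ} (hg : g.totalDegree ≤ D)
    {x s t : ℂ} (z : Fin n → ℂ) (hx : s * t * conj t = x) :
    reflected g D x s t z = (s * t) ^ D * conj (eval (fun a => t * z a) g) := by
  rw [eval_mul_eq_sum hg, map_sum, Finset.mul_sum, reflected]
  refine Finset.sum_congr rfl fun b hb => ?_
  have hb' : b ≤ D := Nat.lt_succ_iff.1 (Finset.mem_range.1 hb)
  rw [← hx, map_mul, map_pow, mul_pow _ (conj t), ← Nat.add_sub_of_le hb', pow_add]
  simp only [Nat.add_sub_cancel_left]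
  ring

theorem infinite_sphere_complex {ρ : ℝ} (hρ : 0 < ρ) : (Metric.sphere (0 : ℂ) ρ).Infinite := by
  have h1 : IsPreconnected (Metric.sphere (0 : ℂ) ρ) :=
    isPreconnected_sphere (by rw [Complex.rank_real_complex]; norm_num) 0 ρ
  refine h1.infinite_of_nontrivial ⟨(ρ : ℂ), ?_, -(ρ : ℂ), ?_, ?_⟩
  · simp [abs_of_pos hρ]
  · simp [abs_of_pos hρ]
  · intro h
    have := congrArg Complex.re h
    simp at this
    linarith

theorem eval_aeval_line (g : MvPolynomial (Fin n) ℂ) (t : ℂ) (z : Fin n → ℂ) :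
    Polynomial.eval t (aeval (fun a => Polynomial.X * Polynomial.C (z a)) g) =
      eval (fun a => t * z a) g := by
  have h : Polynomial.eval t (aeval (fun a => Polynomial.X * Polynomial.C (z a)) g) =
      (Polynomial.aeval t (aeval (fun a => Polynomial.X * Polynomial.C (z a)) g) : ℂ) := by
    rw [Polynomial.coe_aeval_eq_eval]
  rw [h, ← AlgHom.comp_apply, comp_aeval]
  simp only [map_mul, Polynomial.aeval_X, Polynomial.aeval_C, Algebra.algebraMap_self, RingHom.id_apply,
    aeval_eq_eval]

/-- If `‖p‖² = y |q|²` on the sphere `‖z‖² = x`, then the identity extends from circles to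
complex lines. -/
theorem sum_mul_reflected_eq {N D : ℕ} {p : Fin N → MvPolynomial (Fin n) ℂ}
    {q : MvPolynomial (Fin n) ℂ} (hp : ∀ i, (p i).totalDegree ≤ D) (hq : q.totalDegree ≤ D)
    {x : ℝ} (hx : 0 < x) {y : ℂ}
    (h : ∀ z : Fin n → ℂ, ∑ a, z a * conj (z a) = x →
      ∑ i, eval z (p i) * conj (eval z (p i)) = y * (eval z q * conj (eval z q)))
    (z : Fin n → ℂ) {s : ℝ} (hs : 0 < s) (hz : ∑ a, z a * conj (z a) = s) (t : ℂ) :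
    ∑ i, eval (fun a => t * z a) (p i) * reflected (p i) D x s t z =
      y * (eval (fun a => t * z a) q * reflected q D x s t z) := by
  let L : MvPolynomial (Fin n) ℂ → Polynomial ℂ :=
    fun g => aeval (fun a => Polynomial.X * Polynomial.C (z a)) g
  let T : MvPolynomial (Fin n) ℂ → Polynomial ℂ := fun g =>
    ∑ b ∈ Finset.range (D + 1), Polynomial.C ((x : ℂ) ^ b) *
      (Polynomial.C (s : ℂ) * Polynomial.X) ^ (D - b) *
      Polynomial.C (conj (eval z (homogeneousComponent b g)))
  have hL : ∀ g u, Polynomial.eval u (L g) = eval (fun a => u * z a) g :=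
    fun g u => eval_aeval_line g u z
  have hT : ∀ g u, Polynomial.eval u (T g) = reflected g D x s u z := by
    intro g u
    simp [T, reflected, Polynomial.eval_finsetSum]
  -- Both sides are polynomials in the line parameter that agree on the circle of radius `√(x / s)`,
  -- an infinite set.
  have key : ∑ i, L (p i) * T (p i) = Polynomial.C y * (L q * T q) := by
    refine Polynomial.eq_of_infinite_eval_eq _ _
      ((infinite_sphere_complex (Real.sqrt_pos.2 (div_pos hx hs))).mono fun u hu => ?_)
    have hu' : u * conj u = (x / s : ℝ) := by
      rw [Complex.mul_conj, Complex.normSq_eq_norm_sq, mem_sphere_zero_iff_norm.1 hu,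
        Real.sq_sqrt (div_pos hx hs).le]
    have hu2 : (s : ℂ) * u * conj u = x := by
      rw [mul_assoc, hu', ← Complex.ofReal_mul, mul_div_cancel₀ _ hs.ne']
    have h1 := h (fun a => u * z a) (by
      have : ∀ a, u * z a * conj (u * z a) = u * conj u * (z a * conj (z a)) := by
        intro a; rw [map_mul]; ring
      simp_rw [this]
      rw [← Finset.mul_sum, hz, hu', ← Complex.ofReal_mul, div_mul_cancel₀ _ hs.ne'])
    simp only [Set.mem_ofPred_eq, Polynomial.eval_finsetSum, Polynomial.eval_mul,
      Polynomial.eval_C, hL, hT]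
    rw [reflected_eq hq z hu2]
    have : ∀ i, eval (fun a => u * z a) (p i) * reflected (p i) D x s u z =
        (s * u) ^ D * (eval (fun a => u * z a) (p i) * conj (eval (fun a => u * z a) (p i))) := by
      intro i; rw [reflected_eq (hp i) z hu2]; ring
    simp_rw [this]
    rw [← Finset.mul_sum, h1]
    ring
  have := congrArg (Polynomial.eval t) key
  simpa only [Polynomial.eval_finsetSum, Polynomial.eval_mul, Polynomial.eval_C, hL, hT]
    using this

/-- The value at `(z, w)` of a polynomial in `w` whose coefficients are polynomials in `z`. -/
noncomputable def evalPair (z w : Fin n → ℂ) :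
    MvPolynomial (Fin n) (MvPolynomial (Fin n) ℂ) →+* ℂ :=
  (eval w).comp (map (eval z))

/-- The subset `w = conj z` is Zariski dense. -/
theorem eq_zero_of_evalPair_conj (F : MvPolynomial (Fin n) (MvPolynomial (Fin n) ℂ))
    (h : ∀ z : Fin n → ℂ, evalPair z (fun a => conj (z a)) F = 0) : F = 0 := by
  -- The substitution `z = α + iβ`, `w = α - iβ` is invertible and turns `w = conj z` into the real
  -- points `(α, β)`, on which only the zero polynomial vanishes.
  let G : MvPolynomial (Fin n ⊕ Fin n) ℂ :=
    eval₂ (eval₂Hom C fun a => X (Sum.inl a) + C Complex.I * X (Sum.inr a))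
      (fun a => X (Sum.inl a) - C Complex.I * X (Sum.inr a)) F
  have hG : ∀ v : Fin n ⊕ Fin n → ℂ, eval v G =
      evalPair (fun a => v (Sum.inl a) + Complex.I * v (Sum.inr a))
        (fun a => v (Sum.inl a) - Complex.I * v (Sum.inr a)) F := by
    intro v
    have : (eval v).comp (eval₂Hom (eval₂Hom C fun a => X (Sum.inl a) + C Complex.I * X (Sum.inr a))
      (fun a : Fin n => X (Sum.inl a) - C Complex.I * X (Sum.inr a))) =
      evalPair (fun a => v (Sum.inl a) + Complex.I * v (Sum.inr a))
        (fun a => v (Sum.inl a) - Complex.I * v (Sum.inr a)) := by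
      apply ringHom_ext
      · intro c
        simp only [evalPair, RingHom.comp_apply, eval₂Hom_C, map_C, eval_C]
        induction c using MvPolynomial.induction_on with
        | C c => simp
        | add p q hp hq => simp only [map_add, hp, hq]
        | mul_X p a hp => simp only [map_mul, hp]; simp
      · intro a
        simp [evalPair]
    exact RingHom.congr_fun this F
  have hG0 : G = 0 := by
    refine funext_set (fun _ => Set.range ((↑) : ℝ → ℂ))
      (fun _ => Set.infinite_range_of_injective Complex.ofReal_injective) fun v hv => ?_
    rw [hG, map_zero, ← h fun a => v (Sum.inl a) + Complex.I * v (Sum.inr a)]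
    congr 2
    funext a
    obtain ⟨α, hα⟩ := hv (Sum.inl a) trivial
    obtain ⟨β, hβ⟩ := hv (Sum.inr a) trivial
    simp [← hα, ← hβ, sub_eq_add_neg]
  have hF : ∀ z w, evalPair z w F = 0 := by
    intro z w
    have h1 := hG (Sum.elim (fun a => (z a + w a) / 2) fun a => (z a - w a) / (2 * Complex.I))
    rw [hG0, map_zero] at h1
    rw [h1]
    congr 2 <;> funext a <;> simp <;> field_simp [Complex.I_ne_zero] <;> ring
  ext β : 1
  refine MvPolynomial.funext fun z => ?_
  have h1 : map (eval z) F = 0 := MvPolynomial.funext fun w => by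
    rw [map_zero]; exact hF z w
  have h2 := congrArg (coeff β) h1
  rw [coeff_map, coeff_zero] at h2
  rw [h2, coeff_zero, map_zero]

end Homogeneous

/-! ### The denominator divides the numerator -/

section Divisibility

variable {n : ℕ}

/-- The polynomial `g` with conjugated coefficients in the second set of variables. -/
noncomputable def conjPoly : MvPolynomial (Fin n) ℂ →+*
    MvPolynomial (Fin n) (MvPolynomial (Fin n) ℂ) :=
  (map C).comp (map (starRingEnd ℂ))

/-- The bilinear form `∑ a, z a * w a`, the polarization of the squared Hermitian norm. -/
noncomputable def polarNorm (n : ℕ) : MvPolynomial (Fin n) (MvPolynomial (Fin n) ℂ) :=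
  ∑ a, C (X a) * X a

@[simp]
theorem evalPair_C (z w : Fin n → ℂ) (g : MvPolynomial (Fin n) ℂ) :
    evalPair z w (C g) = eval z g := by
  simp [evalPair]

@[simp]
theorem evalPair_smul (z w : Fin n → ℂ) (c : ℂ)
    (F : MvPolynomial (Fin n) (MvPolynomial (Fin n) ℂ)) :
    evalPair z w (c • F) = c * evalPair z w F := by
  rw [Algebra.smul_def, map_mul, MvPolynomial.algebraMap_apply, evalPair_C]
  simp

theorem evalPair_polarNorm (z w : Fin n → ℂ) : evalPair z w (polarNorm n) = ∑ a, z a * w a := by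
  simp [polarNorm, evalPair]

theorem evalPair_conjPoly (z : Fin n → ℂ) (g : MvPolynomial (Fin n) ℂ) :
    evalPair z (fun a => conj (z a)) (conjPoly g) = conj (eval z g) := by
  have : (evalPair z (fun a => conj (z a))).comp conjPoly =
      (starRingEnd ℂ).comp (eval z) := by
    apply ringHom_ext <;> simp [evalPair, conjPoly]
  exact RingHom.congr_fun this g

theorem coeff_conjPoly (α : Fin n →₀ ℕ) (g : MvPolynomial (Fin n) ℂ) :
    coeff α (conjPoly g) = C (conj (coeff α g)) := by
  simp [conjPoly, coeff_map]

theorem coeff_single_polarNorm (a : Fin n) :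
    coeff (Finsupp.single a 1) (polarNorm n) = X a := by
  rw [polarNorm, coeff_sum, Finset.sum_eq_single a]
  · simp
  · intro b _ hb
    rw [coeff_C_mul, coeff_X, if_neg, mul_zero]
    intro h
    exact hb (Finsupp.single_left_injective one_ne_zero h)
  · simp

theorem polarNorm_ne_zero (hn : 2 ≤ n) : polarNorm n ≠ 0 := by
  intro h
  have := coeff_single_polarNorm (⟨0, by omega⟩ : Fin n)
  rw [h, coeff_zero] at this
  exact X_ne_zero _ this.symm

/-- A common divisor has degree `0` in `w` because `q` does, so it divides every coefficient `z_a`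
of the bilinear form. Two distinct variables have no nonconstant common divisor; this is where `n ≥
2` enters. -/
theorem isRelPrime_C_polarNorm (hn : 2 ≤ n) {q : MvPolynomial (Fin n) ℂ} (hq : q ≠ 0) :
    IsRelPrime (C q) (polarNorm n) := by
  intro d hdq hdL
  have hdeg : d.totalDegree = 0 := by
    have := totalDegree_le_of_dvd_of_isDomain hdq (by simpa using hq)
    simpa using this
  obtain ⟨e, rfl⟩ : ∃ e, d = C e := ⟨_, totalDegree_eq_zero_iff_eq_C.1 hdeg⟩
  have he : ∀ a, e ∣ X a := fun a => by
    rw [← coeff_single_polarNorm a]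
    exact (C_dvd_iff_dvd_coeff _ _).1 hdL _
  refine IsUnit.map C ?_
  let a₀ : Fin n := ⟨0, by omega⟩
  let a₁ : Fin n := ⟨1, by omega⟩
  have hne : a₀ ≠ a₁ := by simp [a₀, a₁]
  obtain ⟨u, hu⟩ := he a₀
  refine ((X_prime (R := ℂ) (i := a₀)).irreducible.isUnit_or_isUnit hu).resolve_right fun hunit => ?_
  have h1 : (X a₀ : MvPolynomial (Fin n) ℂ) ∣ X a₁ := by
    rw [hu]
    exact (hunit.mul_right_dvd).2 (he a₁)
  obtain ⟨g, hg⟩ := h1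
  have h2 := congrArg (eval fun a => if a = a₀ then (0 : ℂ) else 1) hg
  simp [hne.symm] at h2

/-- The vectors `v` with `q ∣ ⟨p, v⟩` form a subspace containing all coefficient vectors of `p`. A
vector orthogonal to it is orthogonal to these, so `⟨p, v⟩ = 0` and `v` lies in the subspace as
well; hence `v = 0`. The subspace is everything, and the basis vectors give `q ∣ p i`. -/
theorem dvd_of_dvd_sum_mul_C_conj {N : ℕ} {p : Fin N → MvPolynomial (Fin n) ℂ}
    {q : MvPolynomial (Fin n) ℂ}
    (h : ∀ α, q ∣ ∑ i, p i * C (conj (coeff α (p i)))) (i : Fin N) : q ∣ p i := by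
  classical
  let V : Submodule ℂ (EuclideanSpace ℂ (Fin N)) :=
    { carrier := {v | q ∣ ∑ i, p i * C (conj (v i))}
      add_mem' := by
        intro v w hv hw
        have : ∑ i, p i * C (conj ((v + w) i)) =
            ∑ i, p i * C (conj (v i)) + ∑ i, p i * C (conj (w i)) := by
          rw [← Finset.sum_add_distrib]
          exact Finset.sum_congr rfl fun i _ => by simp [mul_add]
        change q ∣ _
        rw [this]
        exact dvd_add hv hw
      zero_mem' := by
        change q ∣ _
        simp
      smul_mem' := by
        intro c v hv
        have : ∑ i, p i * C (conj ((c • v) i)) = C (conj c) * ∑ i, p i * C (conj (v i)) := by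
          rw [Finset.mul_sum]
          exact Finset.sum_congr rfl fun i _ => by simp; ring
        change q ∣ _
        rw [this]
        exact Dvd.dvd.mul_left hv _ }
  have hcoeff : ∀ α, WithLp.toLp 2 (fun i => coeff α (p i)) ∈ V := h
  have hbot : Vᗮ = ⊥ := by
    rw [eq_bot_iff]
    intro v hv
    have h0 : ∑ i, p i * C (conj (v i)) = 0 := by
      ext α
      have h1 := (Submodule.mem_orthogonal' V v).1 hv _ (hcoeff α)
      rw [PiLp.inner_apply] at h1
      simp only [RCLike.inner_apply] at h1
      simpa [coeff_sum, mul_comm _ (C _), mul_comm _ (conj _)] using h1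
    have hvV : v ∈ V := by
      change q ∣ _
      rw [h0]
      exact dvd_zero q
    exact (Submodule.mem_bot ℂ).2 (inner_self_eq_zero.1 ((Submodule.mem_orthogonal V v).1 hv v hvV))
  have htop : V = ⊤ := (Submodule.orthogonal_eq_bot_iff).1 hbot
  have hi : EuclideanSpace.single i (1 : ℂ) ∈ V := htop ▸ Submodule.mem_top
  have h2 : q ∣ ∑ j, p j * C (conj ((EuclideanSpace.single i (1 : ℂ) : EuclideanSpace ℂ (Fin N)) j)) :=
    hi
  rw [Finset.sum_eq_single i] at h2
  · simpa using h2
  · intro j _ hj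
    simp [hj]
  · simp

/-- If `‖p‖² = y |q|²` with some constant `y` on more than `max (deg p) (deg q)` spheres, then
`q` divides `p`. -/
theorem den_dvd_num_of_spheres (hn : 2 ≤ n) {N D : ℕ} {p : Fin N → MvPolynomial (Fin n) ℂ}
    {q : MvPolynomial (Fin n) ℂ} (hq0 : q ≠ 0) (hp : ∀ i, (p i).totalDegree ≤ D)
    (hq : q.totalDegree ≤ D) (S : Finset ℝ) (hS : D + 1 ≤ S.card)
    (h : ∀ x ∈ S, 0 < x ∧ ∃ y : ℂ, ∀ z : Fin n → ℂ, ∑ a, z a * conj (z a) = x →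
      ∑ i, eval z (p i) * conj (eval z (p i)) = y * (eval z q * conj (eval z q)))
    (i : Fin N) : q ∣ p i := by
  classical
  let P : ℕ → MvPolynomial (Fin n) (MvPolynomial (Fin n) ℂ) := fun b =>
    ∑ i, C (p i) * conjPoly (homogeneousComponent b (p i))
  have key : ∀ x ∈ S, ∃ y : ℂ, ∑ b ∈ Finset.range (D + 1),
      (x : ℂ) ^ b • (polarNorm n ^ (D - b) * P b) = y • (C q * ∑ b ∈ Finset.range (D + 1),
        (x : ℂ) ^ b • (polarNorm n ^ (D - b) * conjPoly (homogeneousComponent b q))) := by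
    intro x hx
    obtain ⟨hx0, y, hy⟩ := h x hx
    refine ⟨y, ?_⟩
    rw [← sub_eq_zero]
    -- The extra factor `polarNorm n` makes the identity trivial at `z = 0`, which spans no complex
    -- line; it is cancelled afterwards.
    refine (mul_eq_zero.1 (eq_zero_of_evalPair_conj (polarNorm n * _)
      fun z => ?_)).resolve_left (polarNorm_ne_zero hn)
    rw [map_mul, evalPair_polarNorm]
    have hs : ∑ a, z a * conj (z a) = ((∑ a, ‖z a‖ ^ 2 : ℝ) : ℂ) := by
      push_cast
      exact Finset.sum_congr rfl fun a _ => Complex.mul_conj' (z a)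
    rcases (Finset.sum_nonneg fun a _ => sq_nonneg ‖z a‖ :
      0 ≤ ∑ a, ‖z a‖ ^ 2).eq_or_lt with h0 | h0
    · rw [hs, ← h0]
      simp
    · refine mul_eq_zero_of_right _ ?_
      have h1 := sum_mul_reflected_eq hp hq hx0 hy z h0 hs 1
      simp only [one_mul, reflected, mul_one] at h1
      rw [map_sub, sub_eq_zero]
      simp only [P, map_sum, map_mul, map_pow, evalPair_smul, evalPair_C, evalPair_conjPoly,
        evalPair_polarNorm, hs]
      refine Eq.trans ?_ (h1.trans ?_)
      · simp only [Finset.mul_sum]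
        rw [Finset.sum_comm]
        exact Finset.sum_congr rfl fun i _ => Finset.sum_congr rfl fun b _ => by ring
      · congr 2
        exact Finset.sum_congr rfl fun b _ => by ring
  have hdvd : ∀ b < D + 1, C q ∣ P b := by
    intro b hb
    -- All `D + 1` coefficients are unknown modulo `C q`, hence the `D + 1` radii.
    have h1 := mem_of_sum_pow_smul_mem
      ((Ideal.span {(C q : MvPolynomial (Fin n) (MvPolynomial (Fin n) ℂ))}).restrictScalars ℂ)
      (S.map ⟨((↑) : ℝ → ℂ), Complex.ofReal_injective⟩) (by simpa using hS)
      (fun b => polarNorm n ^ (D - b) * P b) (by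
        intro x hx
        obtain ⟨x, hxS, rfl⟩ := Finset.mem_map.1 hx
        obtain ⟨y, hy⟩ := key x hxS
        simp only [Function.Embedding.coeFn_mk]
        rw [hy]
        exact Submodule.smul_mem _ _ (Ideal.mem_span_singleton.2 (dvd_mul_right _ _))) hb
    exact (isRelPrime_C_polarNorm hn hq0).pow_right.dvd_of_dvd_mul_left
      (Ideal.mem_span_singleton.1 h1)
  refine dvd_of_dvd_sum_mul_C_conj (fun α => ?_) i
  -- Adding over all degrees reassembles the polarization of `‖p‖²`.
  have hsum : ∑ b ∈ Finset.range (D + 1), P b = ∑ i, C (p i) * conjPoly (p i) := by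
    simp only [P]
    rw [Finset.sum_comm]
    refine Finset.sum_congr rfl fun i _ => ?_
    rw [← Finset.mul_sum, ← map_sum, sum_homogeneousComponent_of_le (hp i)]
  have h2 : C q ∣ ∑ i, C (p i) * conjPoly (p i) := by
    rw [← hsum]
    exact Finset.dvd_sum fun b hb => hdvd b (Finset.mem_range.1 hb)
  have h3 := (C_dvd_iff_dvd_coeff _ _).1 h2 α
  simpa only [coeff_sum, coeff_C_mul, coeff_conjPoly] using h3

end Divisibility

/-! ### Orthogonality of the homogeneous parts -/

section Gram

variable {n N : ℕ}

/-- The Hermitian product of the values at `u` of the homogeneous parts of degrees `a` and `b`. -/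
noncomputable def homGram (p : Fin N → MvPolynomial (Fin n) ℂ) (u : Fin n → ℂ) (a b : ℕ) : ℂ :=
  ∑ i, eval u (homogeneousComponent a (p i)) * conj (eval u (homogeneousComponent b (p i)))

theorem conj_homGram (p : Fin N → MvPolynomial (Fin n) ℂ) (u : Fin n → ℂ) (a b : ℕ) :
    conj (homGram p u a b) = homGram p u b a := by
  simp [homGram, map_sum, mul_comm]

theorem homGram_self (p : Fin N → MvPolynomial (Fin n) ℂ) (u : Fin n → ℂ) (b : ℕ) :
    homGram p u b b = ((∑ i, ‖eval u (homogeneousComponent b (p i))‖ ^ 2 : ℝ) : ℂ) := by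
  simp [homGram, Complex.mul_conj']

theorem sum_eval_mul_conj_eq_sum_homGram {p : Fin N → MvPolynomial (Fin n) ℂ} {D : ℕ}
    (hp : ∀ i, (p i).totalDegree ≤ D) (t : ℂ) (u : Fin n → ℂ) :
    ∑ i, eval (fun a => t * u a) (p i) * conj (eval (fun a => t * u a) (p i)) =
      ∑ b ∈ Finset.range (D + 1), ∑ a ∈ Finset.range (D + 1),
        t ^ a * conj t ^ b * homGram p u a b := by
  have : ∀ i, eval (fun a => t * u a) (p i) * conj (eval (fun a => t * u a) (p i)) =
      ∑ b ∈ Finset.range (D + 1), ∑ a ∈ Finset.range (D + 1), t ^ a * conj t ^ b *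
        (eval u (homogeneousComponent a (p i)) * conj (eval u (homogeneousComponent b (p i)))) := by
    intro i
    rw [eval_mul_eq_sum (hp i), map_sum, Finset.sum_mul_sum, Finset.sum_comm]
    refine Finset.sum_congr rfl fun b _ => Finset.sum_congr rfl fun a _ => ?_
    rw [map_mul, map_pow]
    ring
  simp_rw [this]
  rw [Finset.sum_comm]
  refine Finset.sum_congr rfl fun b _ => ?_
  rw [Finset.sum_comm]
  refine Finset.sum_congr rfl fun a _ => ?_
  rw [homGram, Finset.mul_sum]

/-- This is the coefficient of `t ^ e` in the line identity with `q = 1` and `s = 1`. The reflection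
of `1` is `t ^ D`, so the right side contributes only to `e = D`. -/
theorem sum_pow_mul_homGram {p : Fin N → MvPolynomial (Fin n) ℂ} {D : ℕ}
    (hp : ∀ i, (p i).totalDegree ≤ D) {x : ℝ} (hx : 0 < x) {y : ℂ}
    (h : ∀ z : Fin n → ℂ, ∑ a, z a * conj (z a) = x →
      ∑ i, eval z (p i) * conj (eval z (p i)) = y)
    {u : Fin n → ℂ} (hu : ∑ a, u a * conj (u a) = 1) (e : ℕ) :
    ∑ b ∈ Finset.range (D + 1), (x : ℂ) ^ b •
      (∑ a ∈ Finset.range (D + 1), if a + (D - b) = e then homGram p u a b else 0) =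
      if D = e then y else 0 := by
  have key : ∑ b ∈ Finset.range (D + 1), ∑ a ∈ Finset.range (D + 1),
      Polynomial.monomial (a + (D - b)) ((x : ℂ) ^ b * homGram p u a b) =
      Polynomial.monomial D y := by
    refine Polynomial.funext fun t => ?_
    have h1 := sum_mul_reflected_eq (q := 1) hp (by simp) hx (y := y)
      (fun z hz => by simpa using h z hz) u one_pos (by simpa using hu) t
    have h2 : reflected (1 : MvPolynomial (Fin n) ℂ) D x (1 : ℝ) t u = t ^ D := by
      rw [reflected, Finset.sum_eq_single 0]
      · simp
      · intro b _ hb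
        rw [homogeneousComponent_of_mem (n := 0) (isHomogeneous_one (Fin n) ℂ), if_neg hb]
        simp
      · simp
    rw [h2, map_one, one_mul] at h1
    simp only [Polynomial.eval_finsetSum, Polynomial.eval_monomial]
    rw [← h1]
    simp_rw [eval_mul_eq_sum (hp _), reflected, Finset.sum_mul_sum]
    rw [Finset.sum_comm]
    refine (Finset.sum_congr rfl fun a _ => ?_).trans Finset.sum_comm
    rw [Finset.sum_comm]
    refine Finset.sum_congr rfl fun b _ => ?_
    rw [homGram, Finset.mul_sum, Finset.sum_mul]
    refine Finset.sum_congr rfl fun i _ => ?_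
    rw [Complex.ofReal_one, pow_add]
    ring
  have h3 := congrArg (fun Q => Polynomial.coeff Q e) key
  simp only [Polynomial.finsetSum_coeff, Polynomial.coeff_monomial] at h3
  rw [← h3]
  refine Finset.sum_congr rfl fun b _ => ?_
  rw [Finset.smul_sum]
  refine Finset.sum_congr rfl fun a _ => ?_
  split_ifs <;> simp

/-- A polynomial map of degree at most `D` that maps `D` zero-centric spheres into zero-centric
spheres has orthogonal homogeneous parts, each of constant norm on the unit sphere. -/
theorem homGram_eq_of_spheres {p : Fin N → MvPolynomial (Fin n) ℂ} {D : ℕ}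
    (hp : ∀ i, (p i).totalDegree ≤ D) (S : Finset ℝ) (hS : D ≤ S.card)
    (h : ∀ x ∈ S, 0 < x ∧ ∃ y : ℂ, ∀ z : Fin n → ℂ, ∑ a, z a * conj (z a) = x →
      ∑ i, eval z (p i) * conj (eval z (p i)) = y)
    {u : Fin n → ℂ} (hu : ∑ a, u a * conj (u a) = 1)
    {v : Fin n → ℂ} (hv : ∑ a, v a * conj (v a) = 1)
    {a b : ℕ} (ha : a ≤ D) (hb : b ≤ D) :
    homGram p u a b = if a = b then homGram p v b b else 0 := by
  have hS' : D ≤ (S.map ⟨((↑) : ℝ → ℂ), Complex.ofReal_injective⟩).card := by simpa using hS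
  -- For the exponent `a + (D - b) > D` the term `b' = D` would need `a' > D` and so vanishes. Only
  -- `D` unknowns remain, and `D` spheres suffice.
  have hlt : ∀ a b, b < a → a ≤ D → homGram p u a b = 0 := by
    intro a b hab ha
    have h1 := mem_of_sum_pow_smul_mem (⊥ : Submodule ℂ ℂ) _ hS'
      (fun b' => ∑ a' ∈ Finset.range (D + 1),
        if a' + (D - b') = a + (D - b) then homGram p u a' b' else 0) (by
        intro x hx
        obtain ⟨x, hxS, rfl⟩ := Finset.mem_map.1 hx
        obtain ⟨hx0, y, hy⟩ := h x hxS
        have h2 := sum_pow_mul_homGram hp hx0 hy hu (a + (D - b))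
        have h3 : ∑ a' ∈ Finset.range (D + 1),
            (if a' + (D - D) = a + (D - b) then homGram p u a' D else 0) = 0 := by
          refine Finset.sum_eq_zero fun a' ha' => if_neg ?_
          have := Finset.mem_range.1 ha'
          omega
        rw [if_neg (by omega), Finset.sum_range_succ, h3, smul_zero, add_zero] at h2
        exact h2) (b := b) (by omega)
    rw [Submodule.mem_bot, Finset.sum_eq_single a] at h1
    · simpa using h1
    · intro a' _ hne
      exact if_neg (by omega)
    · intro h'
      exact absurd (Finset.mem_range.2 (by omega)) h'
  rcases lt_trichotomy a b with hab | rfl | hab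
  · rw [if_neg hab.ne, ← conj_homGram, hlt b a hab hb, map_zero]
  · rw [if_pos rfl]
    have hdiag : ∀ w : Fin n → ℂ, ∀ b ≤ D, ∑ a' ∈ Finset.range (D + 1),
        (if a' + (D - b) = D then homGram p w a' b else 0) = homGram p w b b := by
      intro w b hb
      rw [Finset.sum_eq_single b]
      · exact if_pos (by omega)
      · intro a' _ hne
        exact if_neg (by omega)
      · intro h'
        exact absurd (Finset.mem_range.2 (by omega)) h'
    -- The part of degree `0` is the same at `u` and `v`. In the difference of the two diagonal
    -- identities it cancels, and division by `x` leaves `D` unknowns.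
    have hzero : homGram p u 0 0 = homGram p v 0 0 := by simp [homGram]
    rcases a with _ | a
    · exact hzero
    have h1 := mem_of_sum_pow_smul_mem (⊥ : Submodule ℂ ℂ) _ hS'
      (fun b' => homGram p u (b' + 1) (b' + 1) - homGram p v (b' + 1) (b' + 1)) (by
        intro x hx
        obtain ⟨x, hxS, rfl⟩ := Finset.mem_map.1 hx
        obtain ⟨hx0, y, hy⟩ := h x hxS
        have h2 : ∀ w : Fin n → ℂ, ∑ a, w a * conj (w a) = 1 →
            ∑ b ∈ Finset.range D, (x : ℂ) ^ (b + 1) * homGram p w (b + 1) (b + 1) +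
              homGram p w 0 0 = y := by
          intro w hw
          have h3 := sum_pow_mul_homGram hp hx0 hy hw D
          rw [if_pos rfl, Finset.sum_congr rfl fun b hb => by
            rw [hdiag w b (Nat.lt_succ_iff.1 (Finset.mem_range.1 hb))], Finset.sum_range_succ'] at h3
          simpa using h3
        have h4 := (h2 u hu).trans (h2 v hv).symm
        rw [hzero, add_left_inj, ← sub_eq_zero, ← Finset.sum_sub_distrib] at h4
        rw [Submodule.mem_bot]
        refine (mul_eq_zero.1 (?_ : (x : ℂ) * _ = 0)).resolve_left
          (Complex.ofReal_ne_zero.2 hx0.ne')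
        rw [← h4, Finset.mul_sum]
        exact Finset.sum_congr rfl fun b _ => by
          simp only [Function.Embedding.coeFn_mk, smul_eq_mul]; ring) (b := a) (by omega)
    exact sub_eq_zero.1 ((Submodule.mem_bot ℂ).1 h1)
  · rw [if_neg hab.ne', hlt a b hab ha]

theorem exists_eq_mul_unit (hn : 0 < n) (z : Fin n → ℂ) :
    ∃ (t : ℝ) (u : Fin n → ℂ), 0 ≤ t ∧ ∑ a, u a * conj (u a) = 1 ∧ z = fun a => (t : ℂ) * u a := by
  have hs : ∑ a, z a * conj (z a) = ((∑ a, ‖z a‖ ^ 2 : ℝ) : ℂ) := by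
    push_cast
    exact Finset.sum_congr rfl fun a _ => Complex.mul_conj' (z a)
  rcases (Finset.sum_nonneg fun a _ => sq_nonneg ‖z a‖ :
    0 ≤ ∑ a, ‖z a‖ ^ 2).eq_or_lt with h0 | h0
  · refine ⟨0, Pi.single ⟨0, hn⟩ 1, le_rfl, ?_, ?_⟩
    · rw [Finset.sum_eq_single ⟨0, hn⟩]
      · simp
      · intro b _ hb
        simp [hb]
      · simp
    · funext a
      have := (Finset.sum_eq_zero_iff_of_nonneg fun a _ => sq_nonneg ‖z a‖).1 h0.symm a
        (Finset.mem_univ a)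
      simpa using this
  · have hne : (Real.sqrt (∑ a, ‖z a‖ ^ 2) : ℂ) ≠ 0 :=
      Complex.ofReal_ne_zero.2 (Real.sqrt_pos.2 h0).ne'
    refine ⟨Real.sqrt (∑ a, ‖z a‖ ^ 2), fun a => z a / Real.sqrt (∑ a, ‖z a‖ ^ 2),
      Real.sqrt_nonneg _, ?_, ?_⟩
    · have : ∀ a, z a / (Real.sqrt (∑ a, ‖z a‖ ^ 2) : ℂ) *
          conj (z a / (Real.sqrt (∑ a, ‖z a‖ ^ 2) : ℂ)) =
          z a * conj (z a) / ((∑ a, ‖z a‖ ^ 2 : ℝ) : ℂ) := by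
        intro a
        rw [map_div₀, Complex.conj_ofReal, div_mul_div_comm, ← Complex.ofReal_mul,
          Real.mul_self_sqrt h0.le]
      simp_rw [this]
      rw [← Finset.sum_div, hs, div_self (Complex.ofReal_ne_zero.2 h0.ne')]
    · funext a
      rw [mul_div_cancel₀ _ hne]

/-- A polynomial map of degree at most `D` that maps `D` zero-centric spheres into zero-centric
spheres has a squared norm that is a polynomial in the squared norm of the variable. -/
theorem exists_sum_eval_mul_conj_eq (hn : 0 < n) {p : Fin N → MvPolynomial (Fin n) ℂ} {D : ℕ}
    (hp : ∀ i, (p i).totalDegree ≤ D) (S : Finset ℝ) (hS : D ≤ S.card)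
    (h : ∀ x ∈ S, 0 < x ∧ ∃ y : ℂ, ∀ z : Fin n → ℂ, ∑ a, z a * conj (z a) = x →
      ∑ i, eval z (p i) * conj (eval z (p i)) = y) :
    ∃ c : ℕ → ℝ, (∀ b, 0 ≤ c b) ∧ (∀ b, D < b → c b = 0) ∧ ∀ z : Fin n → ℂ,
      ∑ i, eval z (p i) * conj (eval z (p i)) =
        ∑ b ∈ Finset.range (D + 1), (c b : ℂ) * (∑ a, z a * conj (z a)) ^ b := by
  obtain ⟨-, v, -, hv, -⟩ := exists_eq_mul_unit hn 0
  -- The coefficient is the squared norm of the part of degree `b` at one unit vector `v`; any other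
  -- would give the same value for `b ≤ D`.
  refine ⟨fun b => ∑ i, ‖eval v (homogeneousComponent b (p i))‖ ^ 2,
    fun b => Finset.sum_nonneg fun i _ => sq_nonneg _,
    fun b hb => Finset.sum_eq_zero fun i _ => ?_, fun z => ?_⟩
  · rw [homogeneousComponent_eq_zero _ _ ((hp i).trans_lt hb)]
    simp
  obtain ⟨t, u, -, hu, rfl⟩ := exists_eq_mul_unit hn z
  rw [sum_eval_mul_conj_eq_sum_homGram hp]
  refine Finset.sum_congr rfl fun b hb => ?_
  rw [← homGram_self, Finset.sum_eq_single b]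
  · have hb' : b ≤ D := Nat.lt_succ_iff.1 (Finset.mem_range.1 hb)
    rw [homGram_eq_of_spheres hp S hS h hu hv hb' hb', if_pos rfl]
    have : ∀ a, (t : ℂ) * u a * conj ((t : ℂ) * u a) = t ^ 2 * (u a * conj (u a)) := by
      intro a
      rw [map_mul, Complex.conj_ofReal]
      ring
    simp_rw [this]
    rw [← Finset.mul_sum, hu, Complex.conj_ofReal, mul_one, ← pow_mul, ← pow_add]
    ring
  · intro a ha hne
    rw [homGram_eq_of_spheres hp S hS h hu hv (Nat.lt_succ_iff.1 (Finset.mem_range.1 ha))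
      (Nat.lt_succ_iff.1 (Finset.mem_range.1 hb)), if_neg hne, mul_zero]
  · exact fun h' => absurd hb h'

end Gram

/-! ### Coefficient vectors and the unitary normal form -/

section Structure

variable {n N : ℕ}

/-- By the multinomial theorem, powers of `∑ z_a w_a` contain only the diagonal monomials `z ^ α w ^
α`; their weights are the squared coefficients of the symmetrized power. -/
theorem coeff_coeff_polarNorm_pow (α β : Fin n →₀ ℕ) (b : ℕ) :
    coeff α (coeff β (polarNorm n ^ b)) =
      if α = β ∧ ∑ a, α a = b then (Nat.multinomial Finset.univ α : ℂ) else 0 := by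
  classical
  have hprod : ∀ k : Fin n → ℕ, ∏ a, (C (X a) * X a :
      MvPolynomial (Fin n) (MvPolynomial (Fin n) ℂ)) ^ k a =
      monomial (Finsupp.equivFunOnFinite.symm k)
        (monomial (Finsupp.equivFunOnFinite.symm k) (1 : ℂ)) := by
    intro k
    simp only [mul_pow, Finset.prod_mul_distrib, ← map_pow, ← map_prod]
    rw [monomial_eq, monomial_eq, Finsupp.prod_fintype _ _ (by simp)]
    simp
  have hterm : ∀ k : Fin n → ℕ, coeff α (coeff β ((Nat.multinomial Finset.univ k :
      MvPolynomial (Fin n) (MvPolynomial (Fin n) ℂ)) *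
        ∏ a, (C (X a) * X a : MvPolynomial (Fin n) (MvPolynomial (Fin n) ℂ)) ^ k a)) =
      if Finsupp.equivFunOnFinite.symm k = β ∧ α = β then
        (Nat.multinomial Finset.univ k : ℂ) else 0 := by
    intro k
    rw [hprod, ← nsmul_eq_mul, coeff_smul, coeff_smul, coeff_monomial]
    by_cases h1 : Finsupp.equivFunOnFinite.symm k = β
    · rw [if_pos h1, coeff_monomial, h1]
      by_cases h2 : β = α
      · simp [h2]
      · rw [if_neg h2, if_neg fun h => h2 h.2.symm, nsmul_zero]
    · rw [if_neg h1, if_neg fun h => h1 h.1, coeff_zero, nsmul_zero]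
  rw [polarNorm, Finset.sum_pow_eq_sum_piAntidiag, coeff_sum, coeff_sum,
    Finset.sum_congr rfl fun k _ => hterm k]
  by_cases h : α = β ∧ ∑ a, α a = b
  · rw [if_pos h, Finset.sum_eq_single (α : Fin n → ℕ)]
    · rw [if_pos ⟨by rw [← h.1]; ext; simp, h.1⟩]
    · intro k _ hk
      refine if_neg fun h' => hk ?_
      rw [h.1, ← h'.1]
      rfl
    · intro h'
      exact absurd (Finset.mem_piAntidiag.2 ⟨h.2, fun _ _ => Finset.mem_univ _⟩) h'
  · rw [if_neg h]
    refine Finset.sum_eq_zero fun k hk => if_neg fun h' => h ⟨h'.2, ?_⟩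
    rw [h'.2, ← h'.1]
    simpa using (Finset.mem_piAntidiag.1 hk).1

/-- If `‖p(z)‖²` is a polynomial in `‖z‖²`, then the coefficient vectors of `p` are orthogonal. -/
theorem sum_coeff_mul_conj_coeff {p : Fin N → MvPolynomial (Fin n) ℂ} {D : ℕ} {c : ℕ → ℝ}
    (hcD : ∀ b, D < b → c b = 0)
    (h : ∀ z : Fin n → ℂ, ∑ i, eval z (p i) * conj (eval z (p i)) =
      ∑ b ∈ Finset.range (D + 1), (c b : ℂ) * (∑ a, z a * conj (z a)) ^ b)
    (α β : Fin n →₀ ℕ) :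
    ∑ i, coeff α (p i) * conj (coeff β (p i)) =
      if α = β then (c (∑ a, α a) : ℂ) * (Nat.multinomial Finset.univ α : ℂ) else 0 := by
  have key : ∑ i, C (p i) * conjPoly (p i) =
      ∑ b ∈ Finset.range (D + 1), (c b : ℂ) • polarNorm n ^ b := by
    rw [← sub_eq_zero]
    refine eq_zero_of_evalPair_conj _ fun z => ?_
    rw [map_sub, sub_eq_zero]
    simp only [map_sum, map_mul, map_pow, evalPair_C, evalPair_conjPoly, evalPair_smul,
      evalPair_polarNorm]
    exact h z
  have h1 := congrArg (fun F => coeff α (coeff β F)) key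
  simp only [coeff_sum, coeff_C_mul, coeff_conjPoly, coeff_smul, coeff_coeff_polarNorm_pow,
    smul_eq_mul] at h1
  have h2 : ∀ i, coeff α (p i * C (conj (coeff β (p i)))) =
      coeff α (p i) * conj (coeff β (p i)) := by
    intro i
    rw [mul_comm, coeff_C_mul, mul_comm]
  simp_rw [h2] at h1
  rw [h1]
  by_cases hαβ : α = β
  · rw [if_pos hαβ, Finset.sum_eq_single (∑ a, α a)]
    · rw [if_pos ⟨hαβ, rfl⟩]
    · intro b _ hb
      rw [if_neg fun h' => hb h'.2.symm, mul_zero]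
    · intro h'
      rw [hcD _ (by simpa [Nat.lt_succ_iff] using h')]
      simp
  · rw [if_neg hαβ]
    exact Finset.sum_eq_zero fun b _ => by rw [if_neg fun h' => hαβ h'.1, mul_zero]

theorem finite_multiIndex (n d : ℕ) : Finite {α : Fin n → ℕ // ∑ a, α a = d} := by
  classical
  refine ((Finset.piAntidiag Finset.univ d).finite_toSet.subset fun α hα => ?_ :
    Set.Finite {α : Fin n → ℕ | ∑ a, α a = d})
  exact Finset.mem_coe.2 (Finset.mem_piAntidiag.2 ⟨hα, fun _ _ => Finset.mem_univ _⟩)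

theorem isHomogeneous_C_mul_prod_X_pow (r : ℂ) (α : Fin n → ℕ) :
    (C r * ∏ a, X a ^ α a : MvPolynomial (Fin n) ℂ).IsHomogeneous (∑ a, α a) := by
  have h1 := (isHomogeneous_C (Fin n) r).mul
    (IsHomogeneous.prod Finset.univ (fun a => (X a : MvPolynomial (Fin n) ℂ) ^ α a) α
      fun a _ => isHomogeneous_X_pow a _)
  rwa [zero_add] at h1

theorem IsScaledSymmetrizedPower.isHomogeneousSphereMap {l d : ℕ} {c : ℝ}
    {h : CSpace n → CSpace l} (hh : IsScaledSymmetrizedPower d c h) (hc : 0 < c) :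
    IsHomogeneousSphereMap d h := by
  classical
  obtain ⟨σ, hσ⟩ := hh
  refine ⟨⟨fun i => C ((c : ℂ) * (Real.sqrt (Nat.multinomial Finset.univ (σ i).1) : ℂ)) *
    ∏ a, X a ^ (σ i).1 a, fun i => ?_, fun z i => ?_⟩, 1, c, one_pos, hc, fun z hz => ?_⟩
  · have h1 := isHomogeneous_C_mul_prod_X_pow
      ((c : ℂ) * (Real.sqrt (Nat.multinomial Finset.univ (σ i).1) : ℂ)) (σ i).1
    rwa [(σ i).2] at h1
  · rw [hσ]
    simp
  · let _ : Fintype {α : Fin n → ℕ // ∑ a, α a = d} := Fintype.ofEquiv _ σ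
    have hz1 : ∑ a, ‖z a‖ ^ 2 = 1 := by
      rw [← EuclideanSpace.norm_sq_eq, mem_sphere_zero_iff_norm.1 hz, one_pow]
    have h1 : ∀ i, ‖h z i‖ ^ 2 = c ^ 2 * ((Nat.multinomial Finset.univ (σ i).1 : ℝ) *
        ∏ a, (‖z a‖ ^ 2) ^ (σ i).1 a) := by
      intro i
      rw [hσ, norm_mul, norm_mul, norm_prod, Complex.norm_real, Complex.norm_real, mul_pow,
        mul_pow, Real.norm_eq_abs, Real.norm_eq_abs, sq_abs, sq_abs,
        Real.sq_sqrt (Nat.cast_nonneg _), ← Finset.prod_pow, mul_assoc]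
      congr 2
      refine Finset.prod_congr rfl fun a _ => ?_
      rw [norm_pow, pow_right_comm]
    have h2 : ‖h z‖ ^ 2 = c ^ 2 := by
      rw [EuclideanSpace.norm_sq_eq, Finset.sum_congr rfl fun i _ => h1 i, ← Finset.mul_sum,
        Equiv.sum_comp σ (fun α => (Nat.multinomial Finset.univ α.1 : ℝ) *
          ∏ a, (‖z a‖ ^ 2) ^ α.1 a),
        ← Finset.sum_subtype (Finset.piAntidiag Finset.univ d) (by simp)
          (fun α : Fin n → ℕ => (Nat.multinomial Finset.univ α : ℝ) * ∏ a, (‖z a‖ ^ 2) ^ α a),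
        ← Finset.sum_pow_eq_sum_piAntidiag, hz1, one_pow, mul_one]
    rw [mem_sphere_zero_iff_norm]
    exact (sq_eq_sq₀ (norm_nonneg _) hc.le).1 h2

/-- An orthonormal family indexed by a sum of blocks is the image of the first standard basis
vectors under a unitary map. -/
theorem exists_unitary_directSumZero {k : ℕ} {l : Fin k → ℕ} {v : (Σ j, Fin (l j)) → CSpace N}
    (hv : Orthonormal ℂ v) :
    ∑ j, l j ≤ N ∧ ∃ U : CSpace N ≃ₗᵢ[ℂ] CSpace N, ∀ (h : ∀ j, CSpace n → CSpace (l j)) z,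
      U (directSumZero N h z) = ∑ x : Σ j, Fin (l j), h x.1 z x.2 • v x := by
  classical
  have hcard : ∑ j, l j ≤ N := by
    have := hv.linearIndependent.fintype_card_le_finrank
    simpa using this
  refine ⟨hcard, ?_⟩
  let w : Fin N → CSpace N := fun i =>
    if hi : i.1 < ∑ j, l j then v (finSigmaFinEquiv.symm ⟨i.1, hi⟩) else 0
  have hw : Orthonormal ℂ (Set.domRestrict {i : Fin N | i.1 < ∑ j, l j} w) := by
    have h1 : Set.domRestrict {i : Fin N | i.1 < ∑ j, l j} w =
        v ∘ fun i => finSigmaFinEquiv.symm ⟨i.1.1, i.2⟩ := by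
      funext i
      exact dif_pos i.2
    rw [h1]
    refine hv.comp _ fun i j hij => ?_
    have := finSigmaFinEquiv.symm.injective hij
    exact Subtype.ext (Fin.ext (Fin.mk.inj_iff.1 this))
  obtain ⟨B, hB⟩ := hw.exists_orthonormalBasis_extension_of_card_eq (by simp)
  refine ⟨B.repr.symm, fun h z => ?_⟩
  rw [← OrthonormalBasis.sum_repr_symm]
  symm
  refine Fintype.sum_of_injective (fun x => Fin.castLE hcard (finSigmaFinEquiv x))
    (fun x y hxy => finSigmaFinEquiv.injective (Fin.castLE_injective hcard hxy)) _ _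
    (fun i hi => ?_) fun x => ?_
  · have : ¬ i.1 < ∑ j, l j := fun h' =>
      hi ⟨finSigmaFinEquiv.symm ⟨i.1, h'⟩, by simp⟩
    simp [directSumZero, this]
  · have hlt : (Fin.castLE hcard (finSigmaFinEquiv x)).1 < ∑ j, l j := (finSigmaFinEquiv x).2
    have hx : finSigmaFinEquiv.symm ⟨(Fin.castLE hcard (finSigmaFinEquiv x)).1, hlt⟩ = x :=
      finSigmaFinEquiv.symm_apply_apply x
    rw [hB _ hlt]
    simp only [directSumZero, w, dif_pos hlt]
    rw [hx]

/-- A polynomial map with orthogonal coefficient vectors of the norms prescribed by the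
symmetrized tensor powers is, up to a unitary map, a direct sum of these powers. -/
theorem exists_unitary_eq_directSumZero {p : Fin N → MvPolynomial (Fin n) ℂ} {D : ℕ} {c : ℕ → ℝ}
    (hc0 : ∀ b, 0 ≤ c b) (hcD : ∀ b, D < b → c b = 0)
    (h : ∀ α β : Fin n →₀ ℕ, ∑ i, coeff α (p i) * conj (coeff β (p i)) =
      if α = β then (c (∑ a, α a) : ℂ) * (Nat.multinomial Finset.univ α : ℂ) else 0) :
    ∃ (U : CSpace N ≃ₗᵢ[ℂ] CSpace N) (k : ℕ) (l : Fin k → ℕ)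
      (h : ∀ j, CSpace n → CSpace (l j)) (d : Fin k → ℕ) (c : Fin k → ℝ),
      ∑ j, l j ≤ N ∧ StrictMono d ∧ (∀ j, 0 < c j) ∧
      (∀ j, IsScaledSymmetrizedPower (d j) (c j) (h j)) ∧
      ∀ z : CSpace n, WithLp.toLp 2 (fun i => eval (fun a => z a) (p i)) =
        U (directSumZero N h z) := by
  classical
  -- Degrees with `c b = 0` are dropped, so that the remaining coefficient vectors are nonzero and
  -- can be normalized.
  let s : Finset ℕ := (Finset.range (D + 1)).filter fun b => 0 < c b
  let d : Fin s.card ↪o ℕ := s.orderEmbOfFin rfl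
  have hd : ∀ j, 0 < c (d j) := fun j =>
    (Finset.mem_filter.1 (Finset.orderEmbOfFin_mem s rfl j)).2
  have : ∀ b, Finite {α : Fin n → ℕ // ∑ a, α a = b} := finite_multiIndex n
  let l : Fin s.card → ℕ := fun j => Nat.card {α : Fin n → ℕ // ∑ a, α a = d j}
  let σ : ∀ j, Fin (l j) ≃ {α : Fin n → ℕ // ∑ a, α a = d j} := fun j => (Finite.equivFin _).symm
  let idx : (Σ j, Fin (l j)) → (Fin n →₀ ℕ) := fun x =>
    Finsupp.equivFunOnFinite.symm (σ x.1 x.2).1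
  have hidx : ∀ x, ∑ a, idx x a = d x.1 := fun x => (σ x.1 x.2).2
  have hinj : Function.Injective idx := by
    rintro ⟨j, i⟩ ⟨j', i'⟩ hxy
    have hj : j = j' := d.injective (by
      rw [← hidx ⟨j, i⟩, ← hidx ⟨j', i'⟩, hxy])
    subst hj
    have := (σ j).injective (Subtype.ext (Finsupp.equivFunOnFinite.symm.injective hxy))
    exact congrArg (Sigma.mk j) this
  let coef : (Σ j, Fin (l j)) → ℝ := fun x =>
    Real.sqrt (c (d x.1)) * Real.sqrt (Nat.multinomial Finset.univ (σ x.1 x.2).1)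
  have hmult : ∀ x : Σ j, Fin (l j), (0 : ℝ) < Nat.multinomial Finset.univ (σ x.1 x.2).1 := fun x =>
    Nat.cast_pos.2 (Nat.multinomial_pos _ _)
  have hcoef : ∀ x, coef x ≠ 0 := fun x =>
    (mul_pos (Real.sqrt_pos.2 (hd _)) (Real.sqrt_pos.2 (hmult x))).ne'
  have hcoef2 : ∀ x, (coef x : ℂ) * coef x =
      (c (∑ a, idx x a) : ℂ) * (Nat.multinomial Finset.univ (idx x) : ℂ) := by
    intro x
    rw [hidx, ← Complex.ofReal_mul, mul_mul_mul_comm, Real.mul_self_sqrt (hd _).le,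
      Real.mul_self_sqrt (hmult x).le]
    push_cast
    rfl
  let e : (Fin n →₀ ℕ) → CSpace N := fun α => WithLp.toLp 2 fun i => coeff α (p i)
  have he : ∀ α β, inner ℂ (e β) (e α) = if α = β then
      (c (∑ a, α a) : ℂ) * (Nat.multinomial Finset.univ α : ℂ) else 0 := by
    intro α β
    rw [← h, PiLp.inner_apply]
    simp [e, RCLike.inner_apply]
  let v : (Σ j, Fin (l j)) → CSpace N := fun x => ((coef x : ℂ)⁻¹) • e (idx x)
  have hv : Orthonormal ℂ v := by
    rw [orthonormal_iff_ite]
    intro x y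
    simp only [v]
    rw [inner_smul_left, inner_smul_right, he, map_inv₀, Complex.conj_ofReal]
    by_cases hxy : x = y
    · subst hxy
      have := Complex.ofReal_ne_zero.2 (hcoef x)
      rw [if_pos rfl, if_pos rfl, ← hcoef2]
      field_simp
    · rw [if_neg hxy, if_neg fun h' => hxy (hinj h').symm, mul_zero, mul_zero]
  obtain ⟨hcard, U, hU⟩ := exists_unitary_directSumZero (n := n) hv
  refine ⟨U, s.card, l, fun j z => WithLp.toLp 2 fun i =>
    (Real.sqrt (c (d j)) : ℂ) * (Real.sqrt (Nat.multinomial Finset.univ (σ j i).1) : ℂ) *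
      ∏ a, z a ^ (σ j i).1 a, d, fun j => Real.sqrt (c (d j)), hcard, d.strictMono,
    fun j => Real.sqrt_pos.2 (hd j), fun j => ⟨σ j, fun z i => rfl⟩, fun z => ?_⟩
  rw [hU]
  -- If `c` vanishes at `|α|`, the coefficient vector of `α` has norm zero, so every monomial that
  -- occurs has an index in some block.
  have hsupp : ∀ i, (p i).support ⊆ Finset.univ.map ⟨idx, hinj⟩ := by
    intro i α hα
    have hpos : 0 < c (∑ a, α a) := by
      refine (hc0 _).lt_of_ne' fun h0 => mem_support_iff.1 hα ?_
      have h1 := h α α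
      rw [if_pos rfl, h0, Complex.ofReal_zero, zero_mul] at h1
      simp only [Complex.mul_conj'] at h1
      have h2 : ∑ i, ‖coeff α (p i)‖ ^ 2 = 0 := by exact_mod_cast h1
      have h3 := (Finset.sum_eq_zero_iff_of_nonneg fun i _ => sq_nonneg _).1 h2 i
        (Finset.mem_univ i)
      simpa using h3
    have hmem : ∑ a, α a ∈ s := by
      refine Finset.mem_filter.2 ⟨Finset.mem_range.2 ?_, hpos⟩
      by_contra h'
      exact hpos.ne' (hcD _ (by omega))
    obtain ⟨j, hj⟩ : ∃ j, d j = ∑ a, α a := by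
      have : ∑ a, α a ∈ Set.range d := by
        rw [Finset.range_orderEmbOfFin]
        exact hmem
      exact this
    refine Finset.mem_map.2 ⟨⟨j, (σ j).symm ⟨α, hj.symm⟩⟩, Finset.mem_univ _, ?_⟩
    ext a
    simp [idx]
  ext i
  have h1 : eval (fun a => z a) (p i) = ∑ x, coeff (idx x) (p i) * ∏ a, z a ^ idx x a := by
    rw [eval_eq', Finset.sum_subset (hsupp i), Finset.sum_map]
    · rfl
    · intro α _ hα
      rw [notMem_support_iff.1 hα, zero_mul]
  have h2 : ∀ x : Σ j, Fin (l j), (((Real.sqrt (c (d x.1)) : ℂ) *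
      (Real.sqrt (Nat.multinomial Finset.univ (σ x.1 x.2).1) : ℂ) *
      ∏ a, z a ^ (σ x.1 x.2).1 a) • v x) i = coeff (idx x) (p i) * ∏ a, z a ^ idx x a := by
    intro x
    have hne := Complex.ofReal_ne_zero.2 (hcoef x)
    have hcx : (Real.sqrt (c (d x.1)) : ℂ) *
        (Real.sqrt (Nat.multinomial Finset.univ (σ x.1 x.2).1) : ℂ) = coef x := by
      push_cast [coef]
      rfl
    rw [hcx]
    simp only [v, e, idx, PiLp.smul_apply, smul_eq_mul, Finsupp.equivFunOnFinite_symm_apply_apply]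
    field_simp
  rw [WithLp.ofLp_sum, Finset.sum_apply, Finset.sum_congr rfl fun x _ => h2 x]
  exact h1

end Structure

/-! ### Application to rational sphere maps -/

namespace RationalMap

variable {n N : ℕ}

theorem totalDegree_num_le (f : RationalMap n N) (i : Fin N) :
    (f.num i).totalDegree ≤ f.degree :=
  (Finset.le_sup (f := fun i => (f.num i).totalDegree) (Finset.mem_univ i)).trans
    (le_max_left _ _)

theorem totalDegree_den_le (f : RationalMap n N) : f.den.totalDegree ≤ f.degree :=
  le_max_right _ _

theorem MapsSphere.sum_eval_num_mul_conj {f : RationalMap n N} {r R : ℝ} (h : f.MapsSphere r R)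
    (hr : 0 < r) (z : Fin n → ℂ) (hz : ∑ a, z a * conj (z a) = ((r ^ 2 : ℝ) : ℂ)) :
    ∑ i, eval z (f.num i) * conj (eval z (f.num i)) =
      (R : ℂ) ^ 2 * (eval z f.den * conj (eval z f.den)) := by
  have hmem : WithLp.toLp 2 z ∈ Metric.sphere (0 : CSpace n) r := by
    rw [mem_sphere_zero_iff_norm]
    refine (sq_eq_sq₀ (norm_nonneg _) hr.le).1 ?_
    rw [EuclideanSpace.norm_sq_eq]
    simp only [Complex.mul_conj'] at hz
    exact_mod_cast hz
  have hden : eval z f.den ≠ 0 := fun h0 => Set.disjoint_left.1 h.1 h0 hmem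
  have hR := mem_sphere_zero_iff_norm.1 (h.2 hmem)
  have hR2 : ∑ i, ‖eval z (f.num i) / eval z f.den‖ ^ 2 = R ^ 2 := by
    rw [← hR, EuclideanSpace.norm_sq_eq]
    rfl
  have hR3 : ∑ i, ‖eval z (f.num i)‖ ^ 2 = R ^ 2 * ‖eval z f.den‖ ^ 2 := by
    rw [← hR2, Finset.sum_mul]
    refine Finset.sum_congr rfl fun i _ => ?_
    rw [norm_div, div_pow, div_mul_cancel₀ _ (pow_ne_zero 2 (norm_ne_zero_iff.2 hden))]
  simp only [Complex.mul_conj']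
  exact_mod_cast hR3

theorem isPolynomial_of_den_dvd {f : RationalMap n N} (h : ∀ i, f.den ∣ f.num i) :
    f.IsPolynomial := by
  choose P hP using h
  exact ⟨P, hP⟩

/-- The denominator divides itself and every numerator, so lowest terms make it a nonzero constant.
Dividing by it does not raise the degree. -/
theorem IsPolynomial.exists_polynomials {f : RationalMap n N} (h : f.IsPolynomial) :
    f.poleSet = ∅ ∧ ∃ p : Fin N → MvPolynomial (Fin n) ℂ, (∀ i, (p i).totalDegree ≤ f.degree) ∧
      ∀ z, f.toFun z = WithLp.toLp 2 fun i => eval (fun a => z a) (p i) := by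
  obtain ⟨P, hP⟩ := h
  have hunit : IsUnit f.den := f.reduced _ dvd_rfl fun i => ⟨P i, hP i⟩
  obtain ⟨r, hr, hden⟩ := isUnit_iff_eq_C_of_isReduced.1 hunit
  have hr0 : r ≠ 0 := hr.ne_zero
  refine ⟨?_, fun i => C r⁻¹ * f.num i, fun i => ?_, fun z => ?_⟩
  · ext z
    simp [poleSet, hden, hr0]
  · exact (totalDegree_mul _ _).trans (by simpa using f.totalDegree_num_le i)
  · ext i
    simp [toFun, hden, div_eq_inv_mul]

/-- Squaring keeps the number of positive radii. -/
theorem card_image_sq {S : Finset ℝ} (hS : ∀ r ∈ S, 0 < r) :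
    (S.image fun r => r ^ 2).card = S.card :=
  Finset.card_image_of_injOn fun r hr r' hr' h =>
    (sq_eq_sq₀ (hS r hr).le (hS r' hr').le).1 h

theorem isPolynomial_of_spheres (hn : 2 ≤ n) (f : RationalMap n N) (S : Finset ℝ)
    (hcard : f.degree + 1 ≤ S.card)
    (hS : ∀ r ∈ S, 0 < r ∧ ∃ R : ℝ, 0 < R ∧ f.MapsSphere r R) : f.IsPolynomial := by
  refine isPolynomial_of_den_dvd fun i => den_dvd_num_of_spheres hn f.den_ne_zero
    f.totalDegree_num_le f.totalDegree_den_le (S.image fun r => r ^ 2)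
    (by rwa [card_image_sq fun r hr => (hS r hr).1]) (fun x hx => ?_) i
  obtain ⟨r, hr, rfl⟩ := Finset.mem_image.1 hx
  obtain ⟨hr0, R, -, hR⟩ := hS r hr
  exact ⟨pow_pos hr0 2, _, hR.sum_eval_num_mul_conj hr0⟩

theorem IsPolynomial.exists_norm_sq_eq (hn : 2 ≤ n) {f : RationalMap n N} (hf : f.IsPolynomial)
    (S : Finset ℝ) (hcard : f.degree ≤ S.card)
    (hS : ∀ r ∈ S, 0 < r ∧ ∃ R : ℝ, 0 < R ∧ f.MapsSphere r R) :
    ∃ (p : Fin N → MvPolynomial (Fin n) ℂ) (c : ℕ → ℝ),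
      (∀ z, f.toFun z = WithLp.toLp 2 fun i => eval (fun a => z a) (p i)) ∧
      (∀ b, 0 ≤ c b) ∧ (∀ b, f.degree < b → c b = 0) ∧
      (∀ z : Fin n → ℂ, ∑ i, eval z (p i) * conj (eval z (p i)) =
        ∑ b ∈ Finset.range (f.degree + 1), (c b : ℂ) * (∑ a, z a * conj (z a)) ^ b) ∧
      ∀ z, ‖f.toFun z‖ ^ 2 = ∑ b ∈ Finset.range (f.degree + 1), c b * (‖z‖ ^ 2) ^ b := by
  obtain ⟨-, p, hdeg, hp⟩ := hf.exists_polynomials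
  obtain ⟨c, hc0, hcD, hc⟩ := exists_sum_eval_mul_conj_eq (by omega) hdeg
    (S.image fun r => r ^ 2) (by rwa [card_image_sq fun r hr => (hS r hr).1]) (by
      intro x hx
      obtain ⟨r, hr, rfl⟩ := Finset.mem_image.1 hx
      obtain ⟨hr0, R, -, hR⟩ := hS r hr
      refine ⟨pow_pos hr0 2, ((R ^ 2 : ℝ) : ℂ), fun z hz => ?_⟩
      have hmem : WithLp.toLp 2 z ∈ Metric.sphere (0 : CSpace n) r := by
        rw [mem_sphere_zero_iff_norm]
        refine (sq_eq_sq₀ (norm_nonneg _) hr0.le).1 ?_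
        rw [EuclideanSpace.norm_sq_eq]
        simp only [Complex.mul_conj'] at hz
        exact_mod_cast hz
      have hR' := mem_sphere_zero_iff_norm.1 (hR.2 hmem)
      rw [← hR', hp, EuclideanSpace.norm_sq_eq]
      simp [Complex.mul_conj'])
  refine ⟨p, c, hp, hc0, hcD, hc, fun z => ?_⟩
  have h1 := hc z
  simp only [Complex.mul_conj'] at h1
  rw [hp, EuclideanSpace.norm_sq_eq, EuclideanSpace.norm_sq_eq]
  exact_mod_cast h1

theorem IsPolynomial.exists_mapsSphere (hn : 2 ≤ n) {f : RationalMap n N} (hf : f.IsPolynomial)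
    {S : Finset ℝ} (hne : S.Nonempty) (hcard : f.degree ≤ S.card)
    (hS : ∀ r ∈ S, 0 < r ∧ ∃ R : ℝ, 0 < R ∧ f.MapsSphere r R) {r : ℝ} (hr : 0 < r) :
    ∃ R : ℝ, 0 < R ∧ f.MapsSphere r R := by
  obtain ⟨p, c, -, hc0, -, -, hnorm⟩ := hf.exists_norm_sq_eq hn S hcard hS
  -- One given sphere has a positive image radius, so some `c b` is positive; as all are
  -- nonnegative, the sum is positive for every radius.
  have hpos : 0 < ∑ b ∈ Finset.range (f.degree + 1), c b * (r ^ 2) ^ b := by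
    obtain ⟨r₀, hr₀⟩ := hne
    obtain ⟨hr₀', R₀, hR₀, hmap⟩ := hS r₀ hr₀
    let z : CSpace n := EuclideanSpace.single ⟨0, by omega⟩ (r₀ : ℂ)
    have hz : ‖z‖ = r₀ := by simp [z, abs_of_pos hr₀']
    have h1 := hnorm z
    rw [mem_sphere_zero_iff_norm.1 (hmap.2 (mem_sphere_zero_iff_norm.2 hz)), hz] at h1
    have h2 : ∑ b ∈ Finset.range (f.degree + 1), c b * (r₀ ^ 2) ^ b ≠ 0 := by
      rw [← h1]
      exact (pow_pos hR₀ 2).ne'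
    obtain ⟨b, hb, hb0⟩ := Finset.exists_ne_zero_of_sum_ne_zero h2
    exact Finset.sum_pos' (fun b _ => mul_nonneg (hc0 b) (by positivity))
      ⟨b, hb, mul_pos ((hc0 b).lt_of_ne' (left_ne_zero_of_mul hb0)) (by positivity)⟩
  refine ⟨_, Real.sqrt_pos.2 hpos, ?_, fun z hz => ?_⟩
  · rw [hf.exists_polynomials.1]
    exact Set.empty_disjoint _
  · rw [mem_sphere_zero_iff_norm] at hz ⊢
    rw [← hz, ← hnorm, Real.sqrt_sq (norm_nonneg _)]

theorem IsFoldSphereMap.exists_finset {f : RationalMap n N} {m : ℕ} (h : f.IsFoldSphereMap m) :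
    ∃ S : Finset ℝ, S.card = m ∧ ∀ r ∈ S, 0 < r ∧ ∃ R : ℝ, 0 < R ∧ f.MapsSphere r R := by
  obtain ⟨r, R, hr, hr0, hR0, hmap⟩ := h
  refine ⟨Finset.univ.map ⟨r, hr.injective⟩, by simp, fun x hx => ?_⟩
  obtain ⟨j, -, rfl⟩ := Finset.mem_map.1 hx
  exact ⟨hr0 j, R j, hR0 j, hmap j⟩

theorem IsPolynomial.isInftyFoldSphereMap (hn : 2 ≤ n) {f : RationalMap n N}
    (hf : f.IsPolynomial) {m : ℕ} (hm : 1 ≤ m) (h : f.IsFoldSphereMap m) (hdeg : f.degree ≤ m) :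
    f.IsInftyFoldSphereMap := by
  obtain ⟨S, rfl, hS⟩ := h.exists_finset
  exact (Set.Ioi_infinite (0 : ℝ)).mono fun r hr =>
    ⟨hr, hf.exists_mapsSphere hn (Finset.card_pos.1 hm) hdeg hS hr⟩

theorem IsFoldSphereMap.isPolynomial (hn : 2 ≤ n) {f : RationalMap n N} {m : ℕ}
    (h : f.IsFoldSphereMap m) (hdeg : f.degree + 1 ≤ m) : f.IsPolynomial := by
  obtain ⟨S, rfl, hS⟩ := h.exists_finset
  exact f.isPolynomial_of_spheres hn S hdeg hS

end RationalMap

theorem theorem3 (n N : ℕ) (hn : 2 ≤ n) (f : RationalMap n N) :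
    (∀ m : ℕ, 1 ≤ m → f.IsFoldSphereMap m → f.IsPolynomial → f.degree ≤ m →
      f.IsInftyFoldSphereMap) ∧
    (∀ m : ℕ, 1 ≤ m → f.IsFoldSphereMap m → f.degree + 1 ≤ m →
      f.IsInftyFoldSphereMap) ∧
    (f.IsInftyFoldSphereMap →
      f.IsPolynomial ∧
      (∀ r : ℝ, 0 < r → ∃ R : ℝ, 0 < R ∧ f.MapsSphere r R) ∧
      ∃ (U : CSpace N ≃ₗᵢ[ℂ] CSpace N) (k : ℕ) (l : Fin k → ℕ)
        (h : ∀ j, CSpace n → CSpace (l j)) (d : Fin k → ℕ) (c : Fin k → ℝ),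
        ∑ j, l j ≤ N ∧
        StrictMono d ∧
        (∀ j, 0 < c j) ∧
        (∀ j, IsHomogeneousSphereMap (d j) (h j)) ∧
        (∀ j, IsScaledSymmetrizedPower (d j) (c j) (h j)) ∧
        ∀ z, f.toFun z = U (directSumZero N h z)) := by
  refine ⟨fun m hm hfold hpoly hdeg => hpoly.isInftyFoldSphereMap hn hm hfold hdeg,
    fun m hm hfold hdeg => (hfold.isPolynomial hn hdeg).isInftyFoldSphereMap hn hm hfold
      (by omega), fun hinf => ?_⟩
  -- `f.degree + 1` radii suffice for polynomiality; the structure result then needs only `f.degree`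
  -- of them.
  obtain ⟨S, hSsub, hScard⟩ := hinf.exists_subset_card_eq (f.degree + 1)
  have hS : ∀ r ∈ S, 0 < r ∧ ∃ R : ℝ, 0 < R ∧ f.MapsSphere r R := fun r hr => hSsub hr
  have hpoly := f.isPolynomial_of_spheres hn S hScard.ge hS
  refine ⟨hpoly, fun r hr => hpoly.exists_mapsSphere hn (Finset.card_pos.1 (by omega))
    (by omega) hS hr, ?_⟩
  obtain ⟨p, c, hp, hc0, hcD, hc, -⟩ := hpoly.exists_norm_sq_eq hn S (by omega) hS
  obtain ⟨U, k, l, h, d, c', hl, hd, hc', hpow, hU⟩ :=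
    exists_unitary_eq_directSumZero hc0 hcD (sum_coeff_mul_conj_coeff hcD hc)
  exact ⟨U, k, l, h, d, c', hl, hd, hc', fun j => (hpow j).isHomogeneousSphereMap (hc' j), hpow,
    fun z => (hp z).trans (hU z)⟩
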